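/- Let $\mathbb I=[0,1]$, let $\Sigma=\{1,2\}^{\mathbb N}$ be the space of one-sided sequences $\omega=(\omega_0,\omega_1,\dots)$ with the product topology and left shift $\sigma$, let $\mathbb P$ be the Bernoulli measure on $\Sigma$ giving each symbol probability $1/2$, and let $s$ (the standard measure) be the product of $\mathbb P$ and Lebesgue measure on $\mathbb I$. For $\beta_1,\beta_2\in(0,1)$ put $$g_{1}(y)=y+y(1-y)(y-\beta_1),\qquad g_{2}(y)=y-y(1-y)(y-\beta_2),\qquad G(\omega,y)=(\sigma\omega,g_{\omega_0}(y))\quad\text{on }\Sigma\times\mathbb I,$$ and let $$\Gamma_S=\Big\{(\beta_1,\beta_2)\in(0,1)^2:\ 2-\tfrac1{\beta_1}<\beta_2<\tfrac1{1-\beta_1}-1\Big\}.$$ The basin $\mathcal B(A)$ of a set $A$ is the set of points whose $\omega$-limit set under $G$ is contained in $A$. A compact set $A$ with $G(A)=A$ is a Milnor attractor if $s(\mathcal B(A))>0$ and no compact proper subset $A'\subsetneq A$ has a basin that coincides with $\mathcal B(A)$ up to an $s$-null set. If $R\subseteq\Sigma\times\mathbb I$ is forward invariant and $A\ne A'$ are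 Milnor attractors contained in $R$, their basins are called intermingled in $R$ if every non-empty relatively open subset of $R$ meets each of $\mathcal B(A)$ and $\mathcal B(A')$ in a set of positive $s$-measure. Theorem. Let $(\beta_1,\beta_2)\in\Gamma_S$ with $\beta_1=\beta_2=\beta$. Then $\Sigma\times\{\beta\}$ is a Milnor attractor of $G$, as are $\Sigma\times\{0\}$ and $\Sigma\times\{1\}$. The basins of $\Sigma\times\{0\}$ and $\Sigma\times\{\beta\}$ are intermingled in $\Sigma\times[0,\beta]$, and the basins of $\Sigma\times\{1\}$ and $\Sigma\times\{\beta\}$ are intermingled in $\Sigma\times[\beta,1]$. -/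

import Mathlib

open MeasureTheory Set Filter Topology

noncomputable section

namespace SkewBasin

section General

variable {X : Type*} [TopologicalSpace X]

/-- The basin of attraction of `A` under `F`: the points `x` such that the omega-limit set of `x`
(the set of limit points of the orbit `x, F x, F (F x), …`) is contained in `A`. -/
def basin (F : X → X) (A : Set X) : Set X :=
  {x | omegaLimit atTop (fun n : ℕ => F^[n]) {x} ⊆ A}

/-- A Milnor attractor: a compact set with `F(A) = A`, whose basin has non-zero measure, and such
that no proper compact subset of `A` has the same basin up to a null set. -/
structure IsMilnorAttractor [MeasurableSpace X] (F : X → X) (μ : Measure X) (A : Set X) :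
    Prop where
  isCompact : IsCompact A
  image_eq : F '' A = A
  measure_basin_pos : 0 < μ (basin F A)
  minimal : ∀ A' : Set X, A' ⊂ A → IsCompact A' → ¬ basin F A' =ᵐ[μ] basin F A

/-- Inside the region `R`, the basin of the Milnor attractor `A` is riddled with the basin of
another Milnor attractor `A'`: every non-empty relatively open subset of `R` meets the basin of
`A'` in a set of positive measure. For `R = univ` this concerns all disks of the phase space. -/
structure IsRiddledWithIn [MeasurableSpace X] (F : X → X) (μ : Measure X) (R A A' : Set X) :
    Prop where
  attractor : IsMilnorAttractor F μ A
  attractor' : IsMilnorAttractor F μ A'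
  ne : A ≠ A'
  pos : ∀ U : Set X, IsOpen U → (U ∩ R).Nonempty → 0 < μ (U ∩ R ∩ basin F A')

/-- The basins of `A` and `A'` are intermingled for the restriction of `F` to the forward
invariant region `R` (which contains both sets): each is riddled with the other inside `R`. -/
structure AreIntermingledIn [MeasurableSpace X] (F : X → X) (μ : Measure X) (R A A' : Set X) :
    Prop where
  mapsTo : MapsTo F R R
  subset : A ⊆ R
  subset' : A' ⊆ R
  riddled : IsRiddledWithIn F μ R A A'
  riddled' : IsRiddledWithIn F μ R A' A

end General

/-- One-sided sequences of two symbols, with the product topology. The elements `0` and `1` of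
`Fin 2` stand for the symbols usually written `1` and `2`. -/
abbrev Sequences : Type := ℕ → Fin 2

/-- The Bernoulli measure for which both symbols have probability `1/2`. -/
def bernoulliMeasure : Measure Sequences :=
  Measure.infinitePi (fun _ : ℕ => (PMF.uniformOfFintype (Fin 2)).toMeasure)

/-- The standard measure: the product of the Bernoulli measure and Lebesgue measure on `[0,1]`. -/
def standardMeasure : Measure (Sequences × unitInterval) :=
  bernoulliMeasure.prod volume

/-- The step skew product `(ω, y) ↦ (σ ω, g_{ω₀}(y))`, where `σ` is the left shift. -/
def stepSkewProduct (g : Fin 2 → unitInterval → unitInterval) :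
    Sequences × unitInterval → Sequences × unitInterval :=
  fun z => (fun n => z.1 (n + 1), g (z.1 0) z.2)

/-- The first cubic fiber map `y ↦ y + y (1 - y) (y - β)` of `[0,1]`. -/
def cubicFiber₁ (β y : unitInterval) : unitInterval :=
  ⟨(y : ℝ) + y * (1 - y) * (y - β), by
    obtain ⟨b, hb0, hb1⟩ := β
    obtain ⟨y, hy0, hy1⟩ := y
    have h1 : 0 ≤ 1 + (1 - y) * (y - b) := by nlinarith
    have h2 : 0 ≤ 1 - y * (y - b) := by nlinarith
    constructor
    · have := mul_nonneg hy0 h1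
      simp only
      linarith
    · have := mul_nonneg (sub_nonneg.2 hy1) h2
      simp only
      linarith⟩

/-- The second cubic fiber map `y ↦ y - y (1 - y) (y - β)` of `[0,1]`. -/
def cubicFiber₂ (β y : unitInterval) : unitInterval :=
  ⟨(y : ℝ) - y * (1 - y) * (y - β), by
    obtain ⟨b, hb0, hb1⟩ := β
    obtain ⟨y, hy0, hy1⟩ := y
    have h1 : 0 ≤ 1 - (1 - y) * (y - b) := by nlinarith
    have h2 : 0 ≤ 1 + y * (y - b) := by nlinarith
    constructor
    · have := mul_nonneg hy0 h1
      simp only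
      linarith
    · have := mul_nonneg (sub_nonneg.2 hy1) h2
      simp only
      linarith⟩

/-- The step skew product with the two cubic fiber maps and parameters `β₁`, `β₂`. -/
def cubicSkewProduct (β₁ β₂ : unitInterval) :
    Sequences × unitInterval → Sequences × unitInterval :=
  stepSkewProduct ![cubicFiber₁ β₁, cubicFiber₂ β₂]

/-- The parameter region `Γ_S`. -/
def GammaS : Set (ℝ × ℝ) :=
  {p | p.1 ∈ Ioo (0 : ℝ) 1 ∧ p.2 ∈ Ioo (0 : ℝ) 1 ∧
    2 - 1 / p.1 < p.2 ∧ p.2 < 1 / (1 - p.1) - 1}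

/-- The horizontal set `Σ × {c}`. -/
def level (c : unitInterval) : Set (Sequences × unitInterval) :=
  univ ×ˢ {c}

end SkewBasin

end

/-! When `β₁ = β₂` the two fiber maps average to the identity, so along a random sequence the fiber
coordinate is a bounded martingale. It is handled by two moment identities in place of the general
convergence theorem. Each step adds the mean squared displacement to the second moment, which is at
most 1. The squared displacements therefore have finite expected sum, and almost surely they tend to
zero. Since the displacement is bounded below by a multiple of the product of the distances to the
endpoints of the strip, the orbit converges to an endpoint (`ae_tendsto_endpoint`). The mean stays
at the interior starting point, so neither endpoint can attract almost every sequence, and both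
attract with positive probability (`measure_tendsto_pos`).

Self-similarity of the Bernoulli measure carries this positivity into every cylinder: after a finite
prescribed word the fiber point is still interior and the remaining sequence is again Bernoulli.
Fubini then gives positive measure in every open subset of the strip. Minimality of a level comes
from recurrence: almost every sequence visits every cylinder infinitely often, so a proper compact
subset of the level has null basin. -/

namespace SkewBasin

/-! ### Self-similarity of the Bernoulli measure -/

/-- The left shift on sequences. -/
def shift (ω : Sequences) : Sequences := fun n => ω (n + 1)

/-- The uniform measure on the two symbols. -/
noncomputable def fairCoin : Measure (Fin 2) := (PMF.uniformOfFintype (Fin 2)).toMeasure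

instance : IsProbabilityMeasure fairCoin := by
  unfold fairCoin; infer_instance

instance : IsProbabilityMeasure bernoulliMeasure := by
  unfold bernoulliMeasure; infer_instance

theorem fairCoin_singleton (i : Fin 2) : fairCoin {i} = 2⁻¹ := by
  simp [fairCoin]

theorem integral_fairCoin (f : Fin 2 → ℝ) : ∫ i, f i ∂fairCoin = (f 0 + f 1) / 2 := by
  simp only [fairCoin, PMF.integral_eq_sum, PMF.uniformOfFintype_apply, Fin.sum_univ_two,
    smul_eq_mul]
  simp
  ring

theorem continuous_shift : Continuous shift :=
  continuous_pi fun n => continuous_apply (n + 1)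

theorem measurable_shift : Measurable shift := continuous_shift.measurable

/-- The sequence with first symbol `p.1` followed by `p.2`. -/
def cons (p : Fin 2 × Sequences) : Sequences
  | 0 => p.1
  | n + 1 => p.2 n

theorem measurable_cons : Measurable cons := by
  refine measurable_pi_iff.2 fun n => ?_
  cases n with
  | zero => exact measurable_fst
  | succ n => exact (measurable_pi_apply n).comp measurable_snd

/-- An infinite product measure is determined by its values on finite boxes, and prepending a symbol
shifts the constrained coordinates by one. -/
theorem map_cons : (fairCoin.prod bernoulliMeasure).map cons = bernoulliMeasure := by
  refine Measure.eq_infinitePi _ fun s t ht => ?_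
  have hs : MeasurableSet (Set.pi (s : Set ℕ) t) :=
    MeasurableSet.pi s.countable_toSet fun i _ => ht i
  rw [Measure.map_apply measurable_cons hs]
  set s' : Finset ℕ := s.preimage Nat.succ Nat.succ_injective.injOn
  have hpre : cons ⁻¹' (Set.pi (s : Set ℕ) t) =
      (if 0 ∈ s then t 0 else univ) ×ˢ Set.pi (s' : Set ℕ) (fun n => t (n + 1)) := by
    ext p
    simp only [mem_preimage, Set.mem_pi, mem_prod, s', Finset.coe_preimage, Finset.mem_coe]
    constructor
    · intro h
      refine ⟨?_, fun n hn => h _ hn⟩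
      split_ifs with h0
      · exact h 0 h0
      · trivial
    · rintro ⟨h0, h1⟩ n hn
      cases n with
      | zero => rwa [if_pos hn] at h0
      | succ n => exact h1 n hn
  rw [hpre, Measure.prod_prod, bernoulliMeasure, Measure.infinitePi_pi _ (fun i _ => ht _)]
  have hprod : ∏ i ∈ s', (PMF.uniformOfFintype (Fin 2)).toMeasure (t (i + 1)) =
      ∏ i ∈ s.erase 0, (PMF.uniformOfFintype (Fin 2)).toMeasure (t i) := by
    refine Finset.prod_bij (fun i _ => i + 1) ?_ ?_ ?_ ?_
    · intro i hi
      simpa [s'] using hi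
    · intro i _ j _ h
      simpa using h
    · intro j hj
      obtain ⟨h0, hj⟩ := Finset.mem_erase.1 hj
      obtain ⟨k, rfl⟩ := Nat.exists_eq_succ_of_ne_zero h0
      exact ⟨k, by simpa [s'] using hj, rfl⟩
    · intros; rfl
  rw [hprod]
  split_ifs with h0
  · rw [← Finset.mul_prod_erase s _ h0]; rfl
  · rw [measure_univ, one_mul, Finset.erase_eq_of_notMem h0]

/-- The first symbol and the remaining sequence are independent, with the expected laws. -/
theorem measurePreserving_head_shift :
    MeasurePreserving (fun ω : Sequences => (ω 0, shift ω)) bernoulliMeasure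
      (fairCoin.prod bernoulliMeasure) := by
  have hm : Measurable (fun ω : Sequences => (ω 0, shift ω)) :=
    (measurable_pi_apply 0).prodMk measurable_shift
  refine ⟨hm, ?_⟩
  -- Splitting off the head undoes `cons`, so the pushforward collapses to the identity.
  conv_lhs => rw [← map_cons]
  rw [Measure.map_map hm measurable_cons]
  exact Measure.map_id

theorem measurePreserving_shift : MeasurePreserving shift bernoulliMeasure bernoulliMeasure :=
  measurePreserving_snd.comp measurePreserving_head_shift

theorem measure_head_shift (i : Fin 2) {S : Set Sequences} (hS : MeasurableSet S) :
    bernoulliMeasure {ω | ω 0 = i ∧ shift ω ∈ S} = 2⁻¹ * bernoulliMeasure S := by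
  have := measurePreserving_head_shift.measure_preimage
    ((measurableSet_singleton i).prod hS).nullMeasurableSet
  rw [Measure.prod_prod, fairCoin_singleton] at this
  rw [← this]
  rfl

theorem integral_head_shift {φ : Fin 2 × Sequences → ℝ} (hφ : Continuous φ) :
    ∫ ω, φ (ω 0, shift ω) ∂bernoulliMeasure =
      ((∫ ω, φ (0, ω) ∂bernoulliMeasure) + ∫ ω, φ (1, ω) ∂bernoulliMeasure) / 2 := by
  have hi : Integrable φ (fairCoin.prod bernoulliMeasure) :=
    integrableOn_univ.1 (hφ.continuousOn.integrableOn_compact isCompact_univ)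
  have h := measurePreserving_head_shift.map_eq
  calc ∫ ω, φ (ω 0, shift ω) ∂bernoulliMeasure
      = ∫ p, φ p ∂(fairCoin.prod bernoulliMeasure) := by
        rw [← h, integral_map measurePreserving_head_shift.measurable.aemeasurable
          hφ.measurable.aestronglyMeasurable]
    _ = _ := by rw [integral_prod _ hi, integral_fairCoin]

/-! ### Cylinders and recurrence. -/

theorem mem_cylinder_succ {c ω : Sequences} {n : ℕ} :
    ω ∈ PiNat.cylinder c (n + 1) ↔ ω 0 = c 0 ∧ shift ω ∈ PiNat.cylinder (shift c) n := by
  simp only [PiNat.mem_cylinder_iff, shift]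
  constructor
  · exact fun h => ⟨h 0 (by omega), fun i hi => h (i + 1) (by omega)⟩
  · rintro ⟨h0, h⟩ i hi
    cases i with
    | zero => exact h0
    | succ i => exact h i (by omega)

theorem measurableSet_cylinder (c : Sequences) (n : ℕ) : MeasurableSet (PiNat.cylinder c n) :=
  (PiNat.isOpen_cylinder _ c n).measurableSet

/-- The first `n` symbols are independent of the tail, and each prescribed symbol costs a factor
1/2. -/
theorem measure_cylinder_inter_shift (c : Sequences) (n : ℕ) {S : Set Sequences}
    (hS : MeasurableSet S) :
    bernoulliMeasure (PiNat.cylinder c n ∩ shift^[n] ⁻¹' S) =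
      2⁻¹ ^ n * bernoulliMeasure S := by
  induction n generalizing c with
  | zero => simp
  | succ n ih =>
    rw [pow_succ', mul_assoc, ← ih (shift c), ← measure_head_shift (c 0)
      ((measurableSet_cylinder _ _).inter (measurable_shift.iterate n hS))]
    congr 1
    ext ω
    rw [mem_inter_iff, mem_cylinder_succ, and_assoc]
    rfl

/-- Almost every sequence visits a given cylinder. -/
theorem measure_never_visits (c : Sequences) (n : ℕ) :
    bernoulliMeasure {ω | ∀ k, shift^[k] ω ∉ PiNat.cylinder c n} = 0 := by
  set Z : Set Sequences := {ω | ∀ k, shift^[k] ω ∉ PiNat.cylinder c n} with hZ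
  have hZm : MeasurableSet Z := by
    rw [hZ, ofPred_forall]
    exact MeasurableSet.iInter fun k =>
      (measurable_shift.iterate k (measurableSet_cylinder c n)).compl
  have h1 := measure_cylinder_inter_shift c n hZm
  have h2 : bernoulliMeasure (shift^[n] ⁻¹' Z) = bernoulliMeasure Z :=
    (measurePreserving_shift.iterate n).measure_preimage hZm.nullMeasurableSet
  have hdisj : Disjoint Z (PiNat.cylinder c n ∩ shift^[n] ⁻¹' Z) :=
    Set.disjoint_left.2 fun ω h h' => h 0 h'.1
  -- These two disjoint sets fit inside the preimage of `Z`, which has the same finite measure as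
  -- `Z`. The second one is therefore null, and its measure is a positive multiple of that of `Z`.
  have hsub : Z ∪ (PiNat.cylinder c n ∩ shift^[n] ⁻¹' Z) ⊆ shift^[n] ⁻¹' Z := by
    refine union_subset (fun ω h k => ?_) inter_subset_right
    rw [← Function.iterate_add_apply]
    exact h _
  have h3 := measure_mono (μ := bernoulliMeasure) hsub
  rw [measure_union' hdisj hZm, h2, h1] at h3
  have h4 : 2⁻¹ ^ n * bernoulliMeasure Z ≤ 0 := by
    refine (ENNReal.add_le_add_iff_left (measure_ne_top bernoulliMeasure Z)).1 ?_
    simpa using h3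
  have h5 := nonpos_iff_eq_zero.1 h4
  refine (mul_eq_zero.1 h5).resolve_left ?_
  simp

/-- Almost every sequence visits a given cylinder infinitely often. -/
theorem ae_frequently_mem_cylinder (c : Sequences) (n : ℕ) :
    ∀ᵐ ω ∂bernoulliMeasure, ∃ᶠ k in atTop, shift^[k] ω ∈ PiNat.cylinder c n := by
  have h : ∀ m : ℕ, ∀ᵐ ω ∂bernoulliMeasure,
      ∃ k, shift^[k] (shift^[m] ω) ∈ PiNat.cylinder c n := fun m => by
    refine (measurePreserving_shift.iterate m).quasiMeasurePreserving.ae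
      (p := fun ω => ∃ k, shift^[k] ω ∈ PiNat.cylinder c n) ?_
    rw [ae_iff]
    simpa using measure_never_visits c n
  filter_upwards [ae_all_iff.2 h] with ω hω
  refine frequently_atTop.2 fun m => ?_
  obtain ⟨k, hk⟩ := hω m
  exact ⟨k + m, by omega, by rwa [Function.iterate_add_apply]⟩

/-! ### Orbits of step skew products -/

theorem continuous_stepSkewProduct {g : Fin 2 → unitInterval → unitInterval}
    (hg : ∀ i, Continuous (g i)) : Continuous (stepSkewProduct g) := by
  refine (continuous_shift.comp continuous_fst).prodMk ?_
  have h : Continuous fun p : Fin 2 × unitInterval => g p.1 p.2 :=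
    continuous_prod_of_discrete_left.2 hg
  have h0 : Continuous fun z : Sequences × unitInterval => (z.1 0, z.2) := by fun_prop
  exact h.comp h0

/-- The position in the fiber after `n` steps. -/
noncomputable def fiberOrbit (g : Fin 2 → unitInterval → unitInterval) (n : ℕ) (ω : Sequences)
    (y : unitInterval) : unitInterval :=
  ((stepSkewProduct g)^[n] (ω, y)).2

section Orbit

variable (g : Fin 2 → unitInterval → unitInterval)

theorem fiberOrbit_zero (ω : Sequences) (y : unitInterval) : fiberOrbit g 0 ω y = y := rfl

/-- Peeling off the first step suits conditioning on the first symbol; `fiberOrbit_succ'` peels off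
the last step and exhibits the increments. -/
theorem fiberOrbit_succ (n : ℕ) (ω : Sequences) (y : unitInterval) :
    fiberOrbit g (n + 1) ω y = fiberOrbit g n (shift ω) (g (ω 0) y) := rfl

theorem iterate_stepSkewProduct_fst (n : ℕ) (z : Sequences × unitInterval) :
    ((stepSkewProduct g)^[n] z).1 = shift^[n] z.1 := by
  induction n generalizing z with
  | zero => rfl
  | succ n ih => exact ih _

theorem fiberOrbit_succ' (n : ℕ) (ω : Sequences) (y : unitInterval) :
    fiberOrbit g (n + 1) ω y = g ((shift^[n] ω) 0) (fiberOrbit g n ω y) := by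
  rw [fiberOrbit, Function.iterate_succ_apply', fiberOrbit,
    ← iterate_stepSkewProduct_fst g n (ω, y)]
  rfl

variable {g}

theorem continuous_fiberOrbit (hg : ∀ i, Continuous (g i)) (n : ℕ) :
    Continuous fun z : Sequences × unitInterval => fiberOrbit g n z.1 z.2 :=
  continuous_snd.comp ((continuous_stepSkewProduct hg).iterate n)

theorem mem_basin_level_of_tendsto {c : unitInterval} {z : Sequences × unitInterval}
    (h : Tendsto (fun n => fiberOrbit g n z.1 z.2) atTop (𝓝 c)) :
    z ∈ basin (stepSkewProduct g) (level c) := by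
  intro w hw
  rw [mem_omegaLimit_singleton_iff_mapClusterPt] at hw
  have h2 : MapClusterPt w.2 atTop (fun n => fiberOrbit g n z.1 z.2) :=
    hw.continuousAt_comp continuous_snd.continuousAt
  refine ⟨trivial, ?_⟩
  by_contra hne
  have hd : Disjoint (𝓝 w.2) (𝓝 c) := disjoint_nhds_nhds.2 hne
  exact h2.neBot.ne (hd.mono_right h).eq_bot

theorem image_level {c : unitInterval} (hc : ∀ i, g i c = c) :
    stepSkewProduct g '' level c = level c := by
  ext z
  constructor
  · rintro ⟨w, ⟨-, hw⟩, rfl⟩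
    refine ⟨trivial, ?_⟩
    rw [mem_singleton_iff] at hw ⊢
    simp only [stepSkewProduct, hw, hc]
  · rintro ⟨-, hz⟩
    rw [mem_singleton_iff] at hz
    refine ⟨(cons (0, z.1), c), ⟨trivial, rfl⟩, ?_⟩
    exact Prod.ext rfl ((hc _).trans hz.symm)

theorem isCompact_level (c : unitInterval) : IsCompact (level c) :=
  isCompact_univ.prod isCompact_singleton

/-- Every open neighborhood of a point contains the product of a cylinder and an open set. -/
theorem exists_cylinder_prod_subset {U : Set (Sequences × unitInterval)} (hU : IsOpen U)
    {z : Sequences × unitInterval} (hz : z ∈ U) :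
    ∃ (n : ℕ) (V : Set unitInterval), IsOpen V ∧ z.2 ∈ V ∧ PiNat.cylinder z.1 n ×ˢ V ⊆ U := by
  obtain ⟨C, V, hC, hV, hzC, hzV, hCV⟩ := isOpen_prod_iff.1 hU z.1 z.2 hz
  obtain ⟨_, ⟨x, n, rfl⟩, hx, hxC⟩ :=
    (PiNat.isTopologicalBasis_cylinders (fun _ : ℕ => Fin 2)).exists_subset_of_mem_open hzC hC
  rw [PiNat.mem_cylinder_iff_eq.1 hx |>.symm] at hxC
  exact ⟨n, V, hV, hzV, (prod_mono_left hxC).trans hCV⟩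

/-- A proper compact subset of a level attracts almost nothing. -/
theorem measure_basin_of_ssubset_level {c : unitInterval} {A : Set (Sequences × unitInterval)}
    (hA : A ⊂ level c) (hAc : IsCompact A) :
    standardMeasure (basin (stepSkewProduct g) A) = 0 := by
  obtain ⟨hsub, z, hz, hzA⟩ := ssubset_iff_exists.1 hA
  obtain ⟨n, V, -, hzV, hV⟩ := exists_cylinder_prod_subset hAc.isClosed.isOpen_compl hzA
  have hcyl : IsCompact (PiNat.cylinder z.1 n ×ˢ (univ : Set unitInterval)) := by
    refine IsClosed.isCompact (IsClosed.prod ?_ isClosed_univ)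
    rw [PiNat.cylinder_eq_pi]
    exact isClosed_set_pi fun i _ => isClosed_singleton
  have hae : ∀ᵐ w ∂standardMeasure,
      ∃ᶠ k in atTop, shift^[k] w.1 ∈ PiNat.cylinder z.1 n :=
    (Measure.quasiMeasurePreserving_fst (μ := bernoulliMeasure)
      (ν := (volume : Measure unitInterval))).ae (ae_frequently_mem_cylinder z.1 n)
  refine measure_mono_null (fun w hw => ?_) (ae_iff.1 hae)
  intro hfreq
  -- Infinitely many visits to a compact box force a limit point there. Being in `A`, it has the
  -- fiber coordinate of `z`, hence lies in the neighborhood of `z` that `A` misses.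
  obtain ⟨x, hx, hcl⟩ := hcyl.exists_mapClusterPt_of_frequently
    (f := fun k => (stepSkewProduct g)^[k] w) (hfreq.mono fun k hk => by
      refine ⟨?_, trivial⟩
      rwa [iterate_stepSkewProduct_fst])
  have hxA : x ∈ A := hw ((mem_omegaLimit_singleton_iff_mapClusterPt _ _ _ _).2 hcl)
  have hx2 : x.2 = z.2 := by
    have h1 := (hsub hxA).2
    have h2 := hz.2
    rw [mem_singleton_iff] at h1 h2
    rw [h1, h2]
  exact hV ⟨hx.1, by rwa [hx2]⟩ hxA

theorem isMilnorAttractor_level {c : unitInterval} (hc : ∀ i, g i c = c)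
    (hpos : 0 < standardMeasure (basin (stepSkewProduct g) (level c))) :
    IsMilnorAttractor (stepSkewProduct g) standardMeasure (level c) where
  isCompact := isCompact_level c
  image_eq := image_level hc
  measure_basin_pos := hpos
  minimal A hA hAc h := by
    rw [← measure_congr h, measure_basin_of_ssubset_level hA hAc] at hpos
    exact hpos.false

end Orbit

/-! ### Fair pairs of fiber maps -/

/-- Two fiber maps fixing the endpoints of `[a, b]`, whose average is the identity, and moving each
point of `(a, b)` by a definite amount while staying in `(a, b)`. -/
structure IsFairPair (g : Fin 2 → unitInterval → unitInterval) (a b : unitInterval) (κ : ℝ) :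
    Prop where
  continuous : ∀ i, Continuous (g i)
  lt : a < b
  pos : 0 < κ
  add_eq : ∀ y, (g 0 y : ℝ) + g 1 y = 2 * y
  map_left : ∀ i, g i a = a
  map_right : ∀ i, g i b = b
  mapsTo_Ioo : ∀ i, MapsTo (g i) (Ioo a b) (Ioo a b)
  le_displacement : ∀ y ∈ Ioo a b, κ * ((y - a) * (b - y)) ≤ |(g 0 y : ℝ) - y|

/-- A sequence in `[a, b]` with vanishing increments that accumulates only at the endpoints
converges to one of them. -/
theorem tendsto_endpoint {a b : ℝ} (hab : a < b) {u : ℕ → ℝ} (hu : ∀ n, u n ∈ Icc a b)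
    (hd : Tendsto (fun n => u (n + 1) - u n) atTop (𝓝 0))
    (hp : Tendsto (fun n => (u n - a) * (b - u n)) atTop (𝓝 0)) :
    Tendsto u atTop (𝓝 a) ∨ Tendsto u atTop (𝓝 b) := by
  -- On the middle third the product of the distances to the endpoints is at least `l * l`, and
  -- crossing it takes a jump longer than `l`. Eventually neither happens, so the sequence stays in
  -- one outer third.
  set l := (b - a) / 3 with hl
  have hl0 : 0 < l := by linarith
  have hd' : ∀ᶠ n in atTop, |u (n + 1) - u n| < l := by
    have := hd.abs
    rw [abs_zero] at this
    exact this.eventually (gt_mem_nhds hl0)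
  have hp' : ∀ᶠ n in atTop, (u n - a) * (b - u n) < l * l :=
    hp.eventually (gt_mem_nhds (by positivity))
  obtain ⟨N, hN⟩ := eventually_atTop.1 (hd'.and hp')
  have hside : ∀ n ≥ N, u n < a + l ∨ b - l < u n := by
    intro n hn
    by_contra! h
    have := (hN n hn).2
    nlinarith [mul_nonneg (sub_nonneg.2 h.1) (sub_nonneg.2 h.2)]
  have hlim : Tendsto (fun n => ((u n - a) * (b - u n)) / l) atTop (𝓝 0) := by
    simpa using hp.div_const l
  rcases hside N le_rfl with h0 | h0
  · left
    have hlow : ∀ n ≥ N, u n < a + l := by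
      intro n hn
      induction n, hn using Nat.le_induction with
      | base => exact h0
      | succ n hn ih =>
        refine (hside (n + 1) (by omega)).resolve_right fun h => ?_
        have := abs_lt.1 (hN n hn).1
        linarith
    rw [← tendsto_sub_nhds_zero_iff]
    refine squeeze_zero' (.of_forall fun n => sub_nonneg.2 (hu n).1) ?_ hlim
    filter_upwards [eventually_ge_atTop N] with n hn
    rw [le_div_iff₀ hl0]
    have := hlow n hn
    exact mul_le_mul_of_nonneg_left (by linarith) (sub_nonneg.2 (hu n).1)
  · right
    have hhigh : ∀ n ≥ N, b - l < u n := by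
      intro n hn
      induction n, hn using Nat.le_induction with
      | base => exact h0
      | succ n hn ih =>
        refine (hside (n + 1) (by omega)).resolve_left fun h => ?_
        have := abs_lt.1 (hN n hn).1
        linarith
    have hr : Tendsto (fun n => b - u n) atTop (𝓝 0) := by
      refine squeeze_zero' (.of_forall fun n => sub_nonneg.2 (hu n).2) ?_ hlim
      filter_upwards [eventually_ge_atTop N] with n hn
      rw [le_div_iff₀ hl0, mul_comm]
      have := hhigh n hn
      exact mul_le_mul_of_nonneg_right (by linarith) (sub_nonneg.2 (hu n).2)
    simpa using hr.const_sub b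

theorem volume_inter_Ioo_pos {a b : unitInterval} {V : Set unitInterval} (hV : IsOpen V)
    (h : (V ∩ Ioo a b).Nonempty) : 0 < volume (V ∩ Ioo a b) := by
  obtain ⟨O, hO, rfl⟩ := isOpen_induced_iff.1 hV
  have himg : Subtype.val '' (Subtype.val ⁻¹' O ∩ Ioo a b) = O ∩ Ioo (a : ℝ) b := by
    ext x
    constructor
    · rintro ⟨y, ⟨hyO, hya, hyb⟩, rfl⟩
      exact ⟨hyO, hya, hyb⟩
    · rintro ⟨hxO, hxa, hxb⟩
      exact ⟨⟨x, a.2.1.trans hxa.le, hxb.le.trans b.2.2⟩, ⟨hxO, hxa, hxb⟩, rfl⟩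
  have hvol : volume (Subtype.val ⁻¹' O ∩ Ioo a b) =
      volume (Subtype.val '' (Subtype.val ⁻¹' O ∩ Ioo a b) : Set ℝ) :=
    (MeasurableEmbedding.subtype_coe measurableSet_Icc).comap_apply _ _
  rw [hvol, himg]
  refine (hO.inter isOpen_Ioo).measure_pos _ ?_
  rw [← himg]
  exact h.image _

namespace IsFairPair

variable {g : Fin 2 → unitInterval → unitInterval} {a b : unitInterval} {κ : ℝ}

theorem mapsTo_Icc (h : IsFairPair g a b κ) (i : Fin 2) : MapsTo (g i) (Icc a b) (Icc a b) := by
  rintro y ⟨hay, hyb⟩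
  rcases hay.eq_or_lt with rfl | hay
  · rw [h.map_left]; exact ⟨le_rfl, hyb⟩
  rcases hyb.eq_or_lt with rfl | hyb
  · rw [h.map_right]; exact ⟨hay.le, le_rfl⟩
  exact Ioo_subset_Icc_self (h.mapsTo_Ioo i ⟨hay, hyb⟩)

theorem fiberOrbit_mem_Ioo (h : IsFairPair g a b κ) {y : unitInterval} (hy : y ∈ Ioo a b)
    (ω : Sequences) (n : ℕ) : fiberOrbit g n ω y ∈ Ioo a b := by
  induction n with
  | zero => exact hy
  | succ n ih => rw [fiberOrbit_succ']; exact h.mapsTo_Ioo _ ih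

/-- Both maps move a point equally far in opposite directions, so control of `g 0` controls every
actual increment. -/
theorem abs_displacement (h : IsFairPair g a b κ) (i : Fin 2) (y : unitInterval) :
    |(g i y : ℝ) - y| = |(g 0 y : ℝ) - y| := by
  have := h.add_eq y
  fin_cases i
  · rfl
  · rw [← abs_neg]
    congr 1
    simp only [Fin.mk_one]
    linarith

theorem continuous_coe_fiberOrbit (h : IsFairPair g a b κ) (n : ℕ) (y : unitInterval) :
    Continuous fun ω => (fiberOrbit g n ω y : ℝ) :=
  continuous_subtype_val.comp
    ((continuous_fiberOrbit h.continuous n).comp (Continuous.prodMk_left y))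

/-! ### Moments of the fiber coordinate and convergence to the endpoints. -/

theorem integral_comp_fiberOrbit_succ (h : IsFairPair g a b κ) {φ : unitInterval → ℝ}
    (hφ : Continuous φ) (n : ℕ) (y : unitInterval) :
    ∫ ω, φ (fiberOrbit g (n + 1) ω y) ∂bernoulliMeasure =
      ((∫ ω, φ (fiberOrbit g n ω (g 0 y)) ∂bernoulliMeasure) +
        ∫ ω, φ (fiberOrbit g n ω (g 1 y)) ∂bernoulliMeasure) / 2 := by
  have hc : Continuous fun p : Fin 2 × Sequences => φ (fiberOrbit g n p.2 (g p.1 y)) :=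
    continuous_prod_of_discrete_left.2 fun i => hφ.comp
      ((continuous_fiberOrbit h.continuous n).comp (Continuous.prodMk_left (g i y)))
  exact integral_head_shift hc

/-- The fiber coordinate has constant mean along the orbit. -/
theorem integral_fiberOrbit (h : IsFairPair g a b κ) (n : ℕ) (y : unitInterval) :
    ∫ ω, (fiberOrbit g n ω y : ℝ) ∂bernoulliMeasure = y := by
  induction n generalizing y with
  | zero => simp [fiberOrbit_zero]
  | succ n ih =>
    rw [h.integral_comp_fiberOrbit_succ continuous_subtype_val, ih, ih, h.add_eq]
    ring

theorem continuous_sq_displacement (h : IsFairPair g a b κ) :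
    Continuous fun y : unitInterval => ((g 0 y : ℝ) - y) ^ 2 :=
  ((continuous_subtype_val.comp (h.continuous 0)).sub continuous_subtype_val).pow 2

/-- The second moment grows by the mean squared displacement. -/
theorem integral_sq_fiberOrbit (h : IsFairPair g a b κ) (n : ℕ) (y : unitInterval) :
    ∫ ω, (fiberOrbit g n ω y : ℝ) ^ 2 ∂bernoulliMeasure = (y : ℝ) ^ 2 + ∑ k ∈ Finset.range n,
      ∫ ω, ((g 0 (fiberOrbit g k ω y) : ℝ) - fiberOrbit g k ω y) ^ 2 ∂bernoulliMeasure := by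
  induction n generalizing y with
  | zero => simp [fiberOrbit_zero]
  | succ n ih =>
    rw [h.integral_comp_fiberOrbit_succ (φ := fun y => (y : ℝ) ^ 2)
      (continuous_subtype_val.pow 2), ih, ih, Finset.sum_range_succ']
    simp_rw [h.integral_comp_fiberOrbit_succ h.continuous_sq_displacement]
    rw [← Finset.sum_div, Finset.sum_add_distrib]
    -- With opposite displacements the cross terms cancel: the mean of the two squares is `y ^ 2`
    -- plus the squared displacement.
    have h1 : (g 1 y : ℝ) = 2 * y - g 0 y := by linarith [h.add_eq y]
    simp only [fiberOrbit_zero, integral_const, probReal_univ, one_smul, h1]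
    ring

theorem ae_tendsto_sq_displacement (h : IsFairPair g a b κ) (y : unitInterval) :
    ∀ᵐ ω ∂bernoulliMeasure, Tendsto
      (fun k => ((g 0 (fiberOrbit g k ω y) : ℝ) - fiberOrbit g k ω y) ^ 2) atTop (𝓝 0) := by
  set f : ℕ → Sequences → ℝ := fun k ω =>
    ((g 0 (fiberOrbit g k ω y) : ℝ) - fiberOrbit g k ω y) ^ 2 with hf
  have hfc : ∀ k, Continuous (f k) := fun k => h.continuous_sq_displacement.comp
    ((continuous_fiberOrbit h.continuous k).comp (Continuous.prodMk_left y))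
  have hint : ∀ k, Integrable (f k) bernoulliMeasure := fun k =>
    integrableOn_univ.1 ((hfc k).continuousOn.integrableOn_compact isCompact_univ)
  have hm : ∀ k, Measurable fun ω => ENNReal.ofReal (f k ω) := fun k =>
    (hfc k).measurable.ennreal_ofReal
  have hle : ∫⁻ ω, ∑' k, ENNReal.ofReal (f k ω) ∂bernoulliMeasure ≤ 1 := by
    rw [lintegral_tsum fun k => (hm k).aemeasurable]
    refine ENNReal.tsum_le_of_sum_range_le fun n => ?_
    simp_rw [← fun k => ofReal_integral_eq_lintegral_ofReal (hint k)
      (.of_forall fun ω => sq_nonneg _)]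
    rw [← ENNReal.ofReal_sum_of_nonneg fun k _ => integral_nonneg fun ω => sq_nonneg _,
      ENNReal.ofReal_le_one]
    have h1 := h.integral_sq_fiberOrbit n y
    have h2 : ∫ ω, (fiberOrbit g n ω y : ℝ) ^ 2 ∂bernoulliMeasure ≤ 1 := by
      have : ∫ ω, (fiberOrbit g n ω y : ℝ) ^ 2 ∂bernoulliMeasure ≤
          ∫ _, (1 : ℝ) ∂bernoulliMeasure :=
        integral_mono_of_nonneg (.of_forall fun ω => sq_nonneg _) (integrable_const _)
          (.of_forall fun ω => pow_le_one₀ (fiberOrbit g n ω y).2.1 (fiberOrbit g n ω y).2.2)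
      simpa using this
    nlinarith [sq_nonneg (y : ℝ)]
  filter_upwards [ae_lt_top (Measurable.tsum hm) (hle.trans_lt ENNReal.one_lt_top).ne]
    with ω hω
  have h0 := ENNReal.tendsto_atTop_zero_of_tsum_ne_top hω.ne
  have h1 := (ENNReal.tendsto_toReal ENNReal.zero_ne_top).comp h0
  refine h1.congr fun k => ?_
  exact ENNReal.toReal_ofReal (sq_nonneg _)

/-- Almost every orbit starting in `(a, b)` converges to one of the endpoints. -/
theorem ae_tendsto_endpoint (h : IsFairPair g a b κ) {y : unitInterval} (hy : y ∈ Ioo a b) :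
    ∀ᵐ ω ∂bernoulliMeasure, Tendsto (fun n => fiberOrbit g n ω y) atTop (𝓝 a) ∨
      Tendsto (fun n => fiberOrbit g n ω y) atTop (𝓝 b) := by
  filter_upwards [h.ae_tendsto_sq_displacement y] with ω hω
  have hD : Tendsto (fun k => |(g 0 (fiberOrbit g k ω y) : ℝ) - fiberOrbit g k ω y|)
      atTop (𝓝 0) := by
    have := hω.sqrt
    simpa only [Real.sqrt_sq_eq_abs, Real.sqrt_zero] using this
  rw [tendsto_subtype_rng, tendsto_subtype_rng]
  have hmem := h.fiberOrbit_mem_Ioo hy ω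
  refine tendsto_endpoint h.lt (fun n => ⟨(hmem n).1.le, (hmem n).2.le⟩) ?_ ?_
  · rw [tendsto_zero_iff_abs_tendsto_zero]
    refine hD.congr fun n => ?_
    simp only [Function.comp_apply, fiberOrbit_succ', h.abs_displacement]
  · have hlim := hD.div_const κ
    rw [zero_div] at hlim
    refine squeeze_zero (fun n => mul_nonneg (sub_nonneg.2 (hmem n).1.le)
      (sub_nonneg.2 (hmem n).2.le)) (fun n => ?_) hlim
    rw [le_div_iff₀ h.pos, mul_comm]
    exact h.le_displacement _ (hmem n)

/-- By dominated convergence the constant mean `y` would have to equal the limit `c`. -/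
theorem not_ae_tendsto (h : IsFairPair g a b κ) {y c : unitInterval} (hc : y ≠ c) :
    ¬ ∀ᵐ ω ∂bernoulliMeasure, Tendsto (fun n => fiberOrbit g n ω y) atTop (𝓝 c) := by
  intro hae
  have hlim : Tendsto (fun n => ∫ ω, (fiberOrbit g n ω y : ℝ) ∂bernoulliMeasure) atTop
      (𝓝 (∫ _, (c : ℝ) ∂bernoulliMeasure)) := by
    refine tendsto_integral_of_dominated_convergence (fun _ => 1)
      (fun n => (h.continuous_coe_fiberOrbit n y).measurable.aestronglyMeasurable)
      (integrable_const _) (fun n => .of_forall fun ω => ?_) ?_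
    · rw [Real.norm_of_nonneg (fiberOrbit g n ω y).2.1]
      exact (fiberOrbit g n ω y).2.2
    · filter_upwards [hae] with ω hω using tendsto_subtype_rng.1 hω
  simp only [h.integral_fiberOrbit, integral_const, probReal_univ, one_smul] at hlim
  exact hc (Subtype.ext (tendsto_nhds_unique tendsto_const_nhds hlim))

/-- The sequences whose orbit converges to a given endpoint have positive measure. -/
theorem measure_tendsto_pos (h : IsFairPair g a b κ) {y c : unitInterval} (hy : y ∈ Ioo a b)
    (hc : c = a ∨ c = b) :
    0 < bernoulliMeasure {ω | Tendsto (fun n => fiberOrbit g n ω y) atTop (𝓝 c)} := by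
  rw [pos_iff_ne_zero]
  intro h0
  have h1 : ∀ᵐ ω ∂bernoulliMeasure, ¬ Tendsto (fun n => fiberOrbit g n ω y) atTop (𝓝 c) := by
    rw [ae_iff]; simpa using h0
  rcases hc with rfl | rfl
  · refine h.not_ae_tendsto hy.2.ne ?_
    filter_upwards [h1, h.ae_tendsto_endpoint hy] with ω h2 h3 using h3.resolve_left h2
  · refine h.not_ae_tendsto hy.1.ne' ?_
    filter_upwards [h1, h.ae_tendsto_endpoint hy] with ω h2 h3 using h3.resolve_right h2

/-! ### Positive measure in cylinders and in open sets. -/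

theorem measurableSet_tendsto_fiberOrbit (h : IsFairPair g a b κ) (c : unitInterval) :
    MeasurableSet {z : Sequences × unitInterval |
      Tendsto (fun n => fiberOrbit g n z.1 z.2) atTop (𝓝 c)} :=
  measurableSet_tendsto _ fun n => (continuous_fiberOrbit h.continuous n).measurable

theorem measure_cylinder_tendsto_pos (h : IsFairPair g a b κ) {y c : unitInterval}
    (hy : y ∈ Ioo a b) (hc : c = a ∨ c = b) (x : Sequences) (n : ℕ) :
    0 < bernoulliMeasure (PiNat.cylinder x n ∩
      {ω | Tendsto (fun n => fiberOrbit g n ω y) atTop (𝓝 c)}) := by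
  induction n generalizing x y with
  | zero => simpa using h.measure_tendsto_pos hy hc
  | succ n ih =>
    have hm : MeasurableSet (PiNat.cylinder (shift x) n ∩
        {ω | Tendsto (fun n => fiberOrbit g n ω (g (x 0) y)) atTop (𝓝 c)}) :=
      (measurableSet_cylinder _ _).inter
        (measurable_prodMk_right (h.measurableSet_tendsto_fiberOrbit c))
    have hpos := ENNReal.mul_pos (by simp : (2⁻¹ : ENNReal) ≠ 0)
      (ih (h.mapsTo_Ioo (x 0) hy) (shift x)).ne'
    rw [← measure_head_shift (x 0) hm] at hpos
    refine hpos.trans_le (measure_mono ?_)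
    rintro ω ⟨h0, h1, h2⟩
    refine ⟨mem_cylinder_succ.2 ⟨h0, h1⟩, ?_⟩
    rw [mem_ofPred_eq] at h2 ⊢
    rw [← tendsto_add_atTop_iff_nat 1]
    simpa only [fiberOrbit_succ, h0] using h2

/-- The basin of each boundary level has positive measure in every open subset of the strip. -/
theorem measure_inter_basin_pos (h : IsFairPair g a b κ) {c : unitInterval}
    (hc : c = a ∨ c = b) {U : Set (Sequences × unitInterval)} (hU : IsOpen U)
    (hne : (U ∩ univ ×ˢ Icc a b).Nonempty) :
    0 < standardMeasure (U ∩ univ ×ˢ Icc a b ∩ basin (stepSkewProduct g) (level c)) := by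
  obtain ⟨z, hzU, -, hz⟩ := hne
  obtain ⟨n, V, hV, hzV, hsub⟩ := exists_cylinder_prod_subset hU hzU
  -- The given point may lie on the boundary of the strip, so an interior fiber point is found
  -- nearby.
  have hVne : (V ∩ Ioo a b).Nonempty := by
    have hz' : z.2 ∈ closure (Ioo a b) := by rwa [closure_Ioo h.lt.ne]
    exact mem_closure_iff.1 hz' V hV hzV
  set T := {z : Sequences × unitInterval |
      Tendsto (fun n => fiberOrbit g n z.1 z.2) atTop (𝓝 c)}
  have hT : MeasurableSet T := h.measurableSet_tendsto_fiberOrbit c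
  have hbox : MeasurableSet (PiNat.cylinder z.1 n ×ˢ (V ∩ Ioo a b)) :=
    (measurableSet_cylinder _ _).prod (hV.inter isOpen_Ioo).measurableSet
  have hpos : 0 < standardMeasure (PiNat.cylinder z.1 n ×ˢ (V ∩ Ioo a b) ∩ T) := by
    -- Slicing at fixed `y` reduces the claim to positivity in a cylinder for each `y` in a set of
    -- positive length.
    rw [standardMeasure, Measure.prod_apply_symm (hbox.inter hT),
      lintegral_pos_iff_support (measurable_measure_prodMk_right (hbox.inter hT))]
    refine (volume_inter_Ioo_pos hV hVne).trans_le (measure_mono fun y hy => ?_)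
    refine ((h.measure_cylinder_tendsto_pos hy.2 hc z.1 n).trans_le (measure_mono ?_)).ne'
    exact fun ω hω => ⟨⟨hω.1, hy⟩, hω.2⟩
  refine hpos.trans_le (measure_mono ?_)
  rintro w ⟨⟨hw1, hw2⟩, hw⟩
  exact ⟨⟨hsub ⟨hw1, hw2.1⟩, trivial, Ioo_subset_Icc_self hw2.2⟩, mem_basin_level_of_tendsto hw⟩

theorem map_endpoint (h : IsFairPair g a b κ) {c : unitInterval} (hc : c = a ∨ c = b) (i : Fin 2) :
    g i c = c := by
  rcases hc with rfl | rfl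
  exacts [h.map_left i, h.map_right i]

theorem isMilnorAttractor (h : IsFairPair g a b κ) {c : unitInterval} (hc : c = a ∨ c = b) :
    IsMilnorAttractor (stepSkewProduct g) standardMeasure (level c) := by
  refine isMilnorAttractor_level (h.map_endpoint hc) ?_
  refine (h.measure_inter_basin_pos hc isOpen_univ ?_).trans_le (measure_mono inter_subset_right)
  exact ⟨(fun _ => 0, a), trivial, trivial, le_rfl, h.lt.le⟩

theorem isRiddledWithIn (h : IsFairPair g a b κ) {c d : unitInterval} (hc : c = a ∨ c = b)
    (hd : d = a ∨ d = b) (hcd : c ≠ d) :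
    IsRiddledWithIn (stepSkewProduct g) standardMeasure (univ ×ˢ Icc a b) (level c)
      (level d) where
  attractor := h.isMilnorAttractor hc
  attractor' := h.isMilnorAttractor hd
  ne heq := by
    have : ((fun _ => 0, c) : Sequences × unitInterval) ∈ level d := by
      rw [← heq]; exact ⟨trivial, rfl⟩
    exact hcd this.2
  pos _ hU hne := h.measure_inter_basin_pos hd hU hne

theorem areIntermingledIn (h : IsFairPair g a b κ) {c d : unitInterval} (hc : c = a ∨ c = b)
    (hd : d = a ∨ d = b) (hcd : c ≠ d) :
    AreIntermingledIn (stepSkewProduct g) standardMeasure (univ ×ˢ Icc a b) (level c)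
      (level d) := by
  have hsub : ∀ {e : unitInterval}, e = a ∨ e = b → level e ⊆ univ ×ˢ Icc a b := by
    rintro e he z ⟨-, hz⟩
    rw [mem_singleton_iff] at hz
    refine ⟨trivial, ?_⟩
    rw [hz]
    rcases he with rfl | rfl
    exacts [⟨le_rfl, h.lt.le⟩, ⟨h.lt.le, le_rfl⟩]
  exact ⟨fun z hz => ⟨trivial, h.mapsTo_Icc _ hz.2⟩, hsub hc, hsub hd,
    h.isRiddledWithIn hc hd hcd, h.isRiddledWithIn hd hc hcd.symm⟩

end IsFairPair

/-! ### The cubic fiber maps -/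

theorem continuous_cubicFibers (β : unitInterval) (i : Fin 2) :
    Continuous (![cubicFiber₁ β, cubicFiber₂ β] i) := by
  fin_cases i
  · refine Continuous.subtype_mk ?_ _
    fun_prop
  · refine Continuous.subtype_mk ?_ _
    fun_prop

theorem cubicFibers_add (β y : unitInterval) :
    ((![cubicFiber₁ β, cubicFiber₂ β] 0 y : unitInterval) : ℝ) +
      (![cubicFiber₁ β, cubicFiber₂ β] 1 y : unitInterval) = 2 * y := by
  simp only [Matrix.cons_val_zero, Matrix.cons_val_one, cubicFiber₁, cubicFiber₂]
  ring

theorem cubicFibers_eq_self {β y : unitInterval}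
    (h : (y : ℝ) * (1 - y) * (y - β) = 0) (i : Fin 2) :
    ![cubicFiber₁ β, cubicFiber₂ β] i y = y := by
  fin_cases i <;> refine Subtype.ext ?_ <;> simp [cubicFiber₁, cubicFiber₂, h]

theorem isFairPair_cubic_lower {β : unitInterval} (h0 : (0 : ℝ) < β) (h1 : (β : ℝ) < 1) :
    IsFairPair ![cubicFiber₁ β, cubicFiber₂ β] 0 β (1 - β) where
  continuous := continuous_cubicFibers β
  lt := h0
  pos := by linarith
  add_eq := cubicFibers_add β
  map_left := cubicFibers_eq_self (by simp)
  map_right := cubicFibers_eq_self (by simp)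
  mapsTo_Ioo i y hy := by
    obtain ⟨y, hy0, hy1⟩ := y
    have hy0 : 0 < y := hy.1
    have hyb : y < β := hy.2
    have h2 := mul_pos hy0 (sub_pos.2 hyb)
    fin_cases i
    · refine ⟨Subtype.coe_lt_coe.1 ?_, Subtype.coe_lt_coe.1 ?_⟩
      · simp only [cubicFiber₁, Fin.zero_eta, Matrix.cons_val_zero, Set.Icc.coe_zero]
        have : 0 < 1 - (1 - y) * (β - y) := by nlinarith
        nlinarith [mul_pos hy0 this]
      · simp only [cubicFiber₁, Fin.zero_eta, Matrix.cons_val_zero]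
        nlinarith [mul_pos h2 (by linarith : 0 < 1 - y)]
    · refine ⟨Subtype.coe_lt_coe.1 ?_, Subtype.coe_lt_coe.1 ?_⟩
      · simp only [cubicFiber₂, Fin.mk_one, Matrix.cons_val_one, Matrix.cons_val_zero, Set.Icc.coe_zero]
        nlinarith [mul_pos h2 (by linarith : 0 < 1 - y)]
      · simp only [cubicFiber₂, Fin.mk_one, Matrix.cons_val_one, Matrix.cons_val_zero]
        have : 0 < 1 - y * (1 - y) := by nlinarith
        nlinarith [mul_pos (sub_pos.2 hyb) this]
  le_displacement y hy := by
    have hy0 : (0 : ℝ) < y := hy.1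
    have hyb : (y : ℝ) < β := hy.2
    refine le_trans ?_ (neg_le_abs _)
    simp only [cubicFiber₁, Matrix.cons_val_zero, Set.Icc.coe_zero]
    -- The constant `1 - β` bounds the factor `1 - y` from below; the excess is exactly `y * (β - y)
    -- ^ 2`.
    nlinarith [mul_pos (mul_pos hy0 (sub_pos.2 hyb)) (sub_pos.2 hyb)]

theorem isFairPair_cubic_upper {β : unitInterval} (h0 : (0 : ℝ) < β) (h1 : (β : ℝ) < 1) :
    IsFairPair ![cubicFiber₁ β, cubicFiber₂ β] β 1 β where
  continuous := continuous_cubicFibers β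
  lt := h1
  pos := h0
  add_eq := cubicFibers_add β
  map_left := cubicFibers_eq_self (by simp)
  map_right := cubicFibers_eq_self (by simp)
  mapsTo_Ioo i y hy := by
    obtain ⟨y, hy0, hy1⟩ := y
    have hy1 : y < 1 := hy.2
    have hby : β < y := hy.1
    have h2 := mul_pos (sub_pos.2 hy1) (sub_pos.2 hby)
    have hy0 : 0 < y := h0.trans hby
    fin_cases i
    · refine ⟨Subtype.coe_lt_coe.1 ?_, Subtype.coe_lt_coe.1 ?_⟩
      · simp only [cubicFiber₁, Fin.zero_eta, Matrix.cons_val_zero]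
        nlinarith [mul_pos h2 hy0]
      · simp only [cubicFiber₁, Fin.zero_eta, Matrix.cons_val_zero, Set.Icc.coe_one]
        have : 0 < 1 - y * (y - β) := by nlinarith
        nlinarith [mul_pos (sub_pos.2 hy1) this]
    · refine ⟨Subtype.coe_lt_coe.1 ?_, Subtype.coe_lt_coe.1 ?_⟩
      · simp only [cubicFiber₂, Fin.mk_one, Matrix.cons_val_one, Matrix.cons_val_zero]
        have : 0 < 1 - y * (1 - y) := by nlinarith
        nlinarith [mul_pos (sub_pos.2 hby) this]
      · simp only [cubicFiber₂, Fin.mk_one, Matrix.cons_val_one, Matrix.cons_val_zero, Set.Icc.coe_one]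
        nlinarith [mul_pos h2 hy0]
  le_displacement y hy := by
    have hy1 : (y : ℝ) < 1 := hy.2
    have hby : (β : ℝ) < y := hy.1
    refine le_trans ?_ (le_abs_self _)
    simp only [cubicFiber₁, Matrix.cons_val_zero, Set.Icc.coe_one]
    -- Here the factor `y` exceeds `β`, with excess `(1 - y) * (y - β) ^ 2`.
    nlinarith [mul_pos (mul_pos (sub_pos.2 hy1) (sub_pos.2 hby)) (sub_pos.2 hby)]

end SkewBasin

theorem theorem4p4 (β₁ β₂ β : unitInterval)
    (hΓ : ((β₁ : ℝ), (β₂ : ℝ)) ∈ SkewBasin.GammaS) (h₁ : β₁ = β) (h₂ : β₂ = β) :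
    SkewBasin.IsMilnorAttractor (SkewBasin.cubicSkewProduct β₁ β₂) SkewBasin.standardMeasure
        (SkewBasin.level β) ∧
      SkewBasin.AreIntermingledIn (SkewBasin.cubicSkewProduct β₁ β₂) SkewBasin.standardMeasure
        (Set.univ ×ˢ Set.Icc 0 β) (SkewBasin.level 0) (SkewBasin.level β) ∧
      SkewBasin.AreIntermingledIn (SkewBasin.cubicSkewProduct β₁ β₂) SkewBasin.standardMeasure
        (Set.univ ×ˢ Set.Icc β 1) (SkewBasin.level 1) (SkewBasin.level β) := by
  subst h₁ h₂
  obtain ⟨⟨h0, h1⟩, -⟩ := hΓ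
  have hl := SkewBasin.isFairPair_cubic_lower h0 h1
  have hu := SkewBasin.isFairPair_cubic_upper h0 h1
  -- That levels `0` and `1` are Milnor attractors is part of the intermingling statements.
  exact ⟨hl.isMilnorAttractor (.inr rfl),
    hl.areIntermingledIn (.inl rfl) (.inr rfl) hl.lt.ne,
    hu.areIntermingledIn (.inr rfl) (.inl rfl) hu.lt.ne'⟩
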